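/- Let $K$ be a field of characteristic $p>0$ (not assumed algebraically closed or perfect), let $n\ge 0$ and $S=K[x_1,\ldots,x_n]$. Let $f\in S$ be an irreducible polynomial that is square-free supported, i.e. every monomial occurring in $f$ with non-zero coefficient is square-free (each variable has exponent at most one in it). Then $S/(f)$ is geometrically F-rational: for every field extension $L$ of $K$, the ring $S/(f)\otimes_K L$ is F-rational. Here a Noetherian ring $R$ of prime characteristic $p$ is called F-rational if every parameter ideal of $R$ is tightly closed. An ideal $I=(g_1,\ldots,g_t)$ is a parameter ideal if for every prime ideal $\mathfrak p\supseteq I$ the images of $g_1,\ldots,g_t$ in $R_{\mathfrak p}$ form part of a system of parameters of $R_{\mathfrak p}$. An ideal $I$ is tightly closed if it equals its tight closure, the set of all $x\in R$ for which there is an element $c\in R$ not contained in any minimal prime of $R$ with $c\,x^{p^e}\in I^{[p^e]}$ for all $e\gg 0$, where $I^{[p^e]}$ is the ideal generated by the $p^e$-th powers of the elements of $I$. -/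

import Mathlib

universe u v

namespace FSingularities

/-- A polynomial over a field is square-free supported if each monomial of its support is
square-free, that is, involves every variable with exponent at most one. -/
def IsSquarefreeSupported {σ : Type u} {K : Type v} [CommSemiring K] (f : MvPolynomial σ K) :
    Prop :=
  ∀ m ∈ f.support, ∀ i, m i ≤ 1

/-- The Frobenius power `I^[p^e]`: the ideal generated by the `p^e`-th powers of the elements
of `I`. -/
def frobeniusPower {R : Type u} [CommRing R] (p : ℕ) (I : Ideal R) (e : ℕ) : Ideal R :=
  Ideal.span ((fun a : R => a ^ p ^ e) '' (I : Set R))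

/-- The tight closure `I^*` of an ideal `I`: the set of all `x` for which there is a `c` outside
every minimal prime of `R` such that `c * x ^ (p ^ e) ∈ I^[p^e]` for all large `e`. -/
def tightClosure {R : Type u} [CommRing R] (p : ℕ) (I : Ideal R) : Set R :=
  {x | ∃ c : R, (∀ P ∈ minimalPrimes R, c ∉ P) ∧
    ∃ e₀ : ℕ, ∀ e ≥ e₀, c * x ^ p ^ e ∈ frobeniusPower p I e}

/-- An ideal is tightly closed if it equals its tight closure. -/
def IsTightlyClosed {R : Type u} [CommRing R] (p : ℕ) (I : Ideal R) : Prop :=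
  tightClosure p I = (I : Set R)

/-- A system of parameters of a (Noetherian) local ring `A`: a sequence of `dim A` elements that
generates an ideal whose radical is the maximal ideal. -/
def IsSystemOfParameters {A : Type u} [CommRing A] [IsLocalRing A] (xs : List A) : Prop :=
  ((xs.length : ℕ∞) : WithBot ℕ∞) = ringKrullDim A ∧
    (Ideal.ofList xs).radical = IsLocalRing.maximalIdeal A

/-- A sequence is part of a system of parameters if it can be extended to one. -/
def IsPartOfSystemOfParameters {A : Type u} [CommRing A] [IsLocalRing A] (xs : List A) : Prop :=
  ∃ ys : List A, IsSystemOfParameters (xs ++ ys)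

/-- A parameter ideal is an ideal `I = (f₁, …, f_t)` such that, for every prime `P ⊇ I`, the images
of `f₁, …, f_t` in `R_P` form part of a system of parameters of `R_P`. -/
def IsParameterIdeal {R : Type u} [CommRing R] (I : Ideal R) : Prop :=
  ∃ fs : List R, I = Ideal.ofList fs ∧
    ∀ (P : Ideal R) [P.IsPrime], I ≤ P →
      IsPartOfSystemOfParameters (fs.map (algebraMap R (Localization.AtPrime P)))

/-- `R` is F-rational: it is a Noetherian ring of prime characteristic `p` in which every parameter
ideal is tightly closed. -/
structure IsFRational (p : ℕ) (R : Type u) [CommRing R] : Prop where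
  prime : p.Prime
  isNoetherianRing : IsNoetherianRing R
  charP : CharP R p
  isTightlyClosed : ∀ I : Ideal R, IsParameterIdeal I → IsTightlyClosed p I

/-- A `K`-algebra `R` is geometrically F-rational if `R ⊗_K L` is F-rational for every field
extension `L` of `K`. -/
def IsGeometricallyFRational.{a, b, c} (p : ℕ) (K : Type a) (R : Type b) [Field K] [CommRing R]
    [Algebra K R] : Prop :=
  ∀ (L : Type c) [Field L] [Algebra K L], IsFRational p (TensorProduct K R L)

end FSingularities

namespace FSingularities

/-! After base change the ring is R = L[x]/(F) with F still square-free supported. All its ideals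
turn out to be tightly closed: every nonzero c in R is sent to 1 by `p⁻ᵉ`-linear maps with e
arbitrarily large, and such a map turns c x^q ∈ I^[q] into x ∈ I.

As in Fedder's criterion, a map φ on L[x] descends to R once premultiplied by F^(q-1), so the goal
is φ(u F^(q-1)) = 1 for a lift u of c. Some xᵢ has degree one in F; multiplying by a power of ∂F/∂xᵢ
makes u free of xᵢ modulo F, and a nonzero polynomial free of xᵢ is never divisible by F.

Since F^(p-1) has degree at most p-1 in each variable, extracting coefficients from u F^(p-1) takes
a degree d of u to at most ⌊(d+p-1)/p⌋ ≤ d, with a strict drop for d ≥ 2. For d = 1 the drop needs a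
monomial with exponent prime to p, which a derivative detects. Iterating reaches a nonzero constant.
The remaining input, that nonzero ∂F/∂xⱼ are nonzerodivisors modulo F, comes from the domain S/(f)
by flatness. -/

/-- An additive map `φ` is `q`-inverse linear if `φ (a ^ q * b) = a * φ b`. For `q = p ^ e` in
characteristic `p` these are the `p⁻ᵉ`-linear (Cartier) maps. -/
def IsInverseLinear {R : Type*} [CommRing R] (q : ℕ) (φ : R →+ R) : Prop :=
  ∀ a b, φ (a ^ q * b) = a * φ b

namespace IsInverseLinear

variable {R : Type*} [CommRing R] {q q' : ℕ} {φ ψ : R →+ R}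

theorem comp (hφ : IsInverseLinear q φ) (hψ : IsInverseLinear q' ψ) :
    IsInverseLinear (q * q') (φ.comp ψ) := fun a b => by
  rw [AddMonoidHom.comp_apply, pow_mul, hψ, hφ, AddMonoidHom.comp_apply]

theorem comp_mulLeft (hφ : IsInverseLinear q φ) (s : R) :
    IsInverseLinear q (φ.comp (AddMonoidHom.mulLeft s)) := fun a b => by
  simp only [AddMonoidHom.comp_apply, AddMonoidHom.coe_mulLeft]
  rw [mul_left_comm, hφ]

theorem map_mem {p e : ℕ} (hφ : IsInverseLinear (p ^ e) φ) {I : Ideal R} {z : R}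
    (hz : z ∈ frobeniusPower p I e) : φ z ∈ I := by
  suffices ∀ t, φ (t * z) ∈ I by simpa using this 1
  refine Submodule.span_induction (p := fun z _ => ∀ t, φ (t * z) ∈ I) ?_ ?_ ?_ ?_ hz
  · rintro _ ⟨a, ha, rfl⟩ t
    rw [mul_comm]
    simpa only [hφ a t] using I.mul_mem_right _ ha
  · simp
  · intro x y _ _ hx hy t
    rw [mul_add, map_add]
    exact I.add_mem (hx t) (hy t)
  · intro a x _ hx t
    rw [smul_eq_mul, ← mul_assoc]
    exact hx _

end IsInverseLinear

/-- If every element outside the minimal primes is sent to `1` by `p⁻ᵉ`-linear maps with `e`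
arbitrarily large, then all ideals are tightly closed. -/
theorem isTightlyClosed_of_exists_isInverseLinear {R : Type*} [CommRing R] (p : ℕ)
    (h : ∀ c : R, (∀ P ∈ minimalPrimes R, c ∉ P) → ∀ e₀, ∃ e ≥ e₀, ∃ φ : R →+ R,
      IsInverseLinear (p ^ e) φ ∧ φ c = 1) (I : Ideal R) : IsTightlyClosed p I := by
  apply Set.Subset.antisymm
  · rintro x ⟨c, hc, e₀, hx⟩
    obtain ⟨e, he, φ, hφ, h1⟩ := h c hc e₀
    have := hφ.map_mem (hx e he)
    rwa [mul_comm, hφ, h1, mul_one] at this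
  · intro x hx
    refine ⟨1, fun P hP h1 => hP.1.1.ne_top ((Ideal.eq_top_iff_one P).2 h1), 0, fun e _ => ?_⟩
    rw [one_mul]
    exact Ideal.subset_span ⟨x, hx, rfl⟩

/-- Over a field of characteristic `p`, every nonzero element is sent to `1` by a `p⁻¹`-linear
map. -/
theorem exists_isInverseLinear_apply_eq_one {L : Type*} [Field L] (p : ℕ) [Fact p.Prime] [CharP L p]
    {c : L} (hc : c ≠ 0) : ∃ φ : L →+ L, IsInverseLinear p φ ∧ φ c = 1 := by
  -- Take a functional over the subfield L^p with value 1 at c, then identify L^p with L by p-th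
  -- roots.
  obtain ⟨f, hf⟩ := Module.Projective.exists_dual_eq_one (frobenius L p).fieldRange hc
  let E := RingEquiv.ofBijective _ (frobenius L p).rangeRestrictField_bijective
  have hE (a : L) : (E a : L) = a ^ p := rfl
  refine ⟨E.symm.toAddEquiv.toAddMonoidHom.comp f.toAddMonoidHom, fun a b => ?_, ?_⟩
  · change E.symm (f (a ^ p * b)) = a * E.symm (f b)
    have : a ^ p * b = (E a) • b := rfl
    rw [this, map_smul, smul_eq_mul, map_mul, E.symm_apply_apply]
  · change E.symm (f c) = 1
    rw [hf, map_one]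

open MvPolynomial

/-! ### Coefficient extraction on polynomial rings -/

section Monomial

variable {σ L : Type*} [Field L]

/-- The additive map on polynomials that extracts the coefficients of the monomials with exponents
`α + p • γ` and applies `l` to them. -/
noncomputable def coeffExtract (p : ℕ) [Fact p.Prime] (α : σ →₀ ℕ) (l : L →+ L) :
    MvPolynomial σ L →+ MvPolynomial σ L where
  toFun w := AddMonoidAlgebra.ofCoeff <|
    (Finsupp.comapDomain (fun γ : σ →₀ ℕ => α + p • γ) (AddMonoidAlgebra.coeff w)
      (fun a _ b _ h => by
        have h' := add_left_cancel h
        ext i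
        have := DFunLike.congr_fun h' i
        simpa [(Fact.out : p.Prime).ne_zero] using this)).mapRange l (map_zero l)
  map_zero' := by ext; simp [MvPolynomial.coeff]
  map_add' a b := by ext; exact map_add l _ _

theorem coeff_coeffExtract (p : ℕ) [Fact p.Prime] (α : σ →₀ ℕ) (l : L →+ L)
    (w : MvPolynomial σ L) (γ : σ →₀ ℕ) :
    (coeffExtract p α l w).coeff γ = l (w.coeff (α + p • γ)) := rfl

theorem isInverseLinear_coeffExtract (p : ℕ) [Fact p.Prime] [CharP L p] {α : σ →₀ ℕ}
    (hα : ∀ i, α i < p) {l : L →+ L} (hl : IsInverseLinear p l) :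
    IsInverseLinear p (coeffExtract (σ := σ) p α l) := by
  intro s w
  induction s using MvPolynomial.induction_on' with
  | add s t hs ht => rw [add_pow_char, add_mul, map_add, hs, ht, add_mul]
  | monomial δ a =>
    ext γ
    rw [monomial_pow, coeff_coeffExtract, coeff_monomial_mul', coeff_monomial_mul']
    -- The residues α lie below p, so they cannot absorb a multiple of p.
    have hle : p • δ ≤ α + p • γ ↔ δ ≤ γ := by
      refine ⟨fun h i => ?_, fun h => (smul_le_smul_of_nonneg_left h p.zero_le).trans
        le_add_self⟩
      have h1 := h i
      have h2 := hα i
      simp only [Finsupp.add_apply, Finsupp.smul_apply, smul_eq_mul] at h1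
      by_contra! hlt
      nlinarith
    rw [if_congr hle rfl rfl]
    split_ifs with h
    · have : α + p • γ - p • δ = α + p • (γ - δ) := by
        ext i
        have := Nat.mul_le_mul_left p (h i)
        simp only [Finsupp.add_apply, Finsupp.smul_apply, smul_eq_mul, Finsupp.tsub_apply,
          Nat.mul_sub]
        omega
      rw [hl, this, coeff_coeffExtract]
    · exact map_zero l

/-- Given a monomial of `w` with exponents `β`, some `p⁻¹`-linear map does not vanish at `w`, and its
value at `w` has degrees bounded in terms of those of `w` and of the residues of `β`. -/
theorem exists_isInverseLinear_degreeOf_le (p : ℕ) [Fact p.Prime] [CharP L p]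
    {w : MvPolynomial σ L} {β : σ →₀ ℕ} (hβ : β ∈ w.support) :
    ∃ φ : MvPolynomial σ L →+ MvPolynomial σ L, IsInverseLinear p φ ∧ φ w ≠ 0 ∧
      ∀ i, degreeOf i (φ w) ≤ (degreeOf i w - β i % p) / p := by
  have hp : 0 < p := (Fact.out : p.Prime).pos
  obtain ⟨l, hl, hl1⟩ := exists_isInverseLinear_apply_eq_one p (mem_support_iff.1 hβ)
  let α : σ →₀ ℕ := β.mapRange (· % p) (Nat.zero_mod p)
  let γ : σ →₀ ℕ := β.mapRange (· / p) (Nat.zero_div p)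
  have hαγ : α + p • γ = β := by
    ext i
    exact Nat.mod_add_div (β i) p
  refine ⟨coeffExtract p α l, isInverseLinear_coeffExtract p (fun i => Nat.mod_lt _ hp) hl,
    fun h => ?_, fun i => degreeOf_le_iff.2 fun m hm => ?_⟩
  · have := coeff_coeffExtract p α l w γ
    rw [h, hαγ, hl1, coeff_zero] at this
    exact zero_ne_one this
  · rw [mem_support_iff, coeff_coeffExtract] at hm
    have hm' : α + p • m ∈ w.support := by
      rw [mem_support_iff]
      exact fun h => hm (by rw [h, map_zero])
    have h := degreeOf_le_iff.1 (le_refl (degreeOf i w)) _ hm'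
    have h1 : (α + p • m) i = β i % p + p * m i := rfl
    rw [Nat.le_div_iff_mul_le hp, mul_comm]
    omega

end Monomial

/-! ### Degree reduction modulo a square-free supported polynomial -/

section SquarefreeSupported

variable {σ L : Type*} [Field L] {F : MvPolynomial σ L}

theorem degreeOf_pderiv_le (u : MvPolynomial σ L) (i : σ) :
    degreeOf i (pderiv i u) ≤ degreeOf i u - 1 := by
  refine degreeOf_le_iff.2 fun m hm => ?_
  rw [mem_support_iff, coeff_pderiv] at hm
  have := degreeOf_le_iff.1 (le_refl (degreeOf i u)) _ (mem_support_iff.2 (left_ne_zero_of_mul hm))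
  simp only [Finsupp.add_apply, Finsupp.single_eq_same] at this
  omega

theorem IsSquarefreeSupported.degreeOf_le (hF : IsSquarefreeSupported F) (i : σ) :
    degreeOf i F ≤ 1 :=
  degreeOf_le_iff.2 fun m hm => hF m hm i

/-- Write F = xᵢ g + h with g and h free of xᵢ; then g = ∂F/∂xᵢ and the difference is h. -/
theorem degreeOf_sub_X_mul_pderiv {i : σ} (hF : degreeOf i F ≤ 1) :
    degreeOf i (F - X i * pderiv i F) = 0 := by
  classical
  refine Nat.le_zero.1 (degreeOf_le_iff.2 fun m hm => ?_)
  by_contra! hi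
  rw [mem_support_iff, coeff_sub, coeff_X_mul', if_pos (Finsupp.mem_support_iff.2 hi.ne'),
    coeff_pderiv, tsub_add_cancel_of_le (Finsupp.single_le_iff.2 hi)] at hm
  have hm0 : coeff m F ≠ 0 := fun h => hm (by rw [h, zero_mul, sub_zero])
  have := degreeOf_le_iff.1 hF m (mem_support_iff.2 hm0)
  have h1 : m i = 1 := by omega
  simp [h1] at hm

theorem pderiv_ne_zero_of_degreeOf_eq_one {i : σ} {u : MvPolynomial σ L} (hu : degreeOf i u = 1) :
    pderiv i u ≠ 0 := fun h => by
  have := degreeOf_sub_X_mul_pderiv hu.le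
  rw [h, mul_zero, sub_zero] at this
  omega

/-- A power of `∂F/∂xᵢ` times a polynomial is congruent to a polynomial free of `xᵢ` modulo `F`. -/
theorem exists_dvd_pderiv_pow_mul_sub {i : σ} (hF : degreeOf i F ≤ 1) (u : MvPolynomial σ L) :
    ∃ N r, degreeOf i r = 0 ∧ F ∣ pderiv i F ^ N * u - r := by
  have hg : degreeOf i (pderiv i F) = 0 := by
    have := degreeOf_pderiv_le F i
    omega
  have hpow (N) : degreeOf i (pderiv i F ^ N) = 0 :=
    Nat.le_zero.1 ((degreeOf_pow_le i _ N).trans (by simp [hg]))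
  have hmul {a b : MvPolynomial σ L} (ha : degreeOf i a = 0) (hb : degreeOf i b = 0) :
      degreeOf i (a * b) = 0 :=
    Nat.le_zero.1 ((degreeOf_mul_le i a b).trans (by simp [ha, hb]))
  induction u using MvPolynomial.induction_on with
  | C a => exact ⟨0, C a, degreeOf_C a i, by simp⟩
  | add u v hu hv =>
    obtain ⟨N, r, hr, s, hs⟩ := hu
    obtain ⟨M, t, ht, s', hs'⟩ := hv
    refine ⟨N + M, pderiv i F ^ M * r + pderiv i F ^ N * t, Nat.le_zero.1
      ((degreeOf_add_le i _ _).trans (by simp [hmul (hpow M) hr, hmul (hpow N) ht])),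
      pderiv i F ^ M * s + pderiv i F ^ N * s', ?_⟩
    linear_combination pderiv i F ^ M * hs + pderiv i F ^ N * hs'
  | mul_X u j hu =>
    obtain ⟨N, r, hr, s, hs⟩ := hu
    by_cases hj : j = i
    · subst hj
      -- One more factor ∂F/∂xⱼ trades xⱼ ∂F/∂xⱼ for xⱼ ∂F/∂xⱼ - F, which is free of xⱼ.
      refine ⟨N + 1, (X j * pderiv j F - F) * r, hmul ?_ hr, X j * pderiv j F * s + r, ?_⟩
      · rw [← degreeOf_neg, neg_sub]
        exact degreeOf_sub_X_mul_pderiv hF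
      · linear_combination X j * pderiv j F * hs
    · refine ⟨N, r * X j, hmul hr (degreeOf_X_of_ne (Ne.symm hj)), s * X j, ?_⟩
      linear_combination X j * hs

variable [Fintype σ] (p : ℕ) [Fact p.Prime] [CharP L p]

/-- The single reduction step. If some degree of u equals 1, the monomial to extract must be chosen
through a derivative; otherwise any monomial works, because degrees at least 2 drop by themselves.
-/
theorem exists_isInverseLinear_mul_pow_sub_one (hF : IsSquarefreeSupported F) (hF0 : F ≠ 0)
    (hreg : ∀ j u, pderiv j F ≠ 0 → F ∣ u * pderiv j F → F ∣ u) {u : MvPolynomial σ L}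
    (hu : ¬ F ∣ u) :
    ∃ φ : MvPolynomial σ L →+ MvPolynomial σ L, IsInverseLinear p φ ∧ φ (u * F ^ (p - 1)) ≠ 0 ∧
      (∀ j, degreeOf j (φ (u * F ^ (p - 1))) ≤ degreeOf j u) ∧
      ((∃ j, degreeOf j u ≠ 0) → ∃ j, degreeOf j (φ (u * F ^ (p - 1))) < degreeOf j u) := by
  have hp : 2 ≤ p := (Fact.out : p.Prime).two_le
  have hdeg (j) : degreeOf j (u * F ^ (p - 1)) ≤ degreeOf j u + (p - 1) := by
    refine (degreeOf_mul_le j _ _).trans (Nat.add_le_add_left ?_ _)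
    refine (degreeOf_pow_le j _ _).trans ?_
    simpa using Nat.mul_le_mul_left (p - 1) (hF.degreeOf_le j)
  have hle (d) : (d + (p - 1)) / p ≤ d := by
    rw [← Nat.lt_succ_iff, Nat.div_lt_iff_lt_mul (by omega)]
    nlinarith [Nat.sub_add_cancel (by omega : 1 ≤ p)]
  have hu0 : u ≠ 0 := fun h => hu (h ▸ dvd_zero F)
  by_cases h1 : ∃ j, degreeOf j u = 1
  · obtain ⟨j, hj⟩ := h1
    -- As p - 1 = -1 in L, vanishing would give F ∂u = u ∂F, hence F ∣ u or ∂u = 0, both excluded.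
    have hd : pderiv j (u * F ^ (p - 1)) ≠ 0 := by
      intro h
      have hp1 : ((p - 1 : ℕ) : MvPolynomial σ L) = -1 := by
        rw [Nat.cast_sub (by omega), CharP.cast_eq_zero]
        simp
      have hpw : F ^ (p - 1) = F ^ (p - 1 - 1) * F := by
        rw [← pow_succ, Nat.sub_add_cancel (by omega)]
      rw [pderiv_mul, pderiv_pow, hp1, hpw] at h
      have h' : F ^ (p - 1 - 1) * (F * pderiv j u - u * pderiv j F) = 0 := by
        linear_combination h
      have h2 := sub_eq_zero.1 ((mul_eq_zero.1 h').resolve_left (pow_ne_zero _ hF0))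
      by_cases h3 : pderiv j F = 0
      · rw [h3, mul_zero] at h2
        exact pderiv_ne_zero_of_degreeOf_eq_one hj ((mul_eq_zero.1 h2).resolve_left hF0)
      · exact hu (hreg j u h3 ⟨_, h2.symm⟩)
    obtain ⟨m, hm⟩ := exists_coeff_ne_zero hd
    rw [coeff_pderiv] at hm
    obtain ⟨φ, hφ, hφ0, hφd⟩ := exists_isInverseLinear_degreeOf_le p
      (mem_support_iff.2 (left_ne_zero_of_mul hm))
    refine ⟨φ, hφ, hφ0, fun k => (hφd k).trans ((Nat.div_le_div_right
      ((Nat.sub_le _ _).trans (hdeg k))).trans (hle _)), fun _ => ⟨j, ?_⟩⟩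
    -- A nonzero residue lowers the bound to (1 + (p - 1) - 1) / p = 0.
    have hmod : (m + Finsupp.single j 1 : σ →₀ ℕ) j % p ≠ 0 := by
      intro h
      refine right_ne_zero_of_mul hm ?_
      have := (CharP.cast_eq_zero_iff L p _).2 (Nat.dvd_of_mod_eq_zero h)
      simpa using this
    refine (hφd j).trans_lt ?_
    rw [Nat.div_lt_iff_lt_mul (by omega)]
    have := hdeg j
    rw [hj] at this ⊢
    omega
  · obtain ⟨β, hβ⟩ := exists_coeff_ne_zero (mul_ne_zero hu0 (pow_ne_zero (p - 1) hF0))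
    obtain ⟨φ, hφ, hφ0, hφd⟩ := exists_isInverseLinear_degreeOf_le p (mem_support_iff.2 hβ)
    have hφd' (k) := (hφd k).trans (Nat.div_le_div_right ((Nat.sub_le _ _).trans (hdeg k)))
    refine ⟨φ, hφ, hφ0, fun k => (hφd' k).trans (hle _), fun ⟨j, hj⟩ => ⟨j, ?_⟩⟩
    have hj1 : degreeOf j u ≠ 1 := fun h => h1 ⟨j, h⟩
    refine (hφd' j).trans_lt ?_
    rw [Nat.div_lt_iff_lt_mul (by omega)]
    obtain ⟨d, hd⟩ := Nat.exists_eq_add_of_le (by omega : 2 ≤ degreeOf j u)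
    obtain ⟨q, rfl⟩ := Nat.exists_eq_add_of_le hp
    rw [hd]
    have : 2 + q - 1 = 1 + q := by omega
    rw [this]
    nlinarith [Nat.zero_le (d * q)]

theorem exists_isInverseLinear_mul_pow_sub_one_eq_one (hF : IsSquarefreeSupported F)
    (hreg : ∀ j u, pderiv j F ≠ 0 → F ∣ u * pderiv j F → F ∣ u) {i : σ} (hi : degreeOf i F = 1)
    {u : MvPolynomial σ L} (hu0 : u ≠ 0) (hu : degreeOf i u = 0) (e₀ : ℕ) :
    ∃ e ≥ e₀, ∃ φ : MvPolynomial σ L →+ MvPolynomial σ L, IsInverseLinear (p ^ e) φ ∧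
      φ (u * F ^ (p ^ e - 1)) = 1 := by
  have hF0 : F ≠ 0 := by
    rintro rfl
    simp at hi
  -- Including e₀ in the measure lets the reduction continue on constants, which makes e as large as
  -- required.
  obtain ⟨N, hN⟩ : ∃ N, N = ∑ j, degreeOf j u + e₀ := ⟨_, rfl⟩
  induction N using Nat.strong_induction_on generalizing u e₀ with
  | _ N ih =>
    have hdvd : ¬ F ∣ u := by
      rintro ⟨v, rfl⟩
      rw [degreeOf_mul_eq hF0 (right_ne_zero_of_mul hu0)] at hu
      omega
    by_cases hdone : e₀ = 0 ∧ ∀ j, degreeOf j u = 0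
    · obtain ⟨rfl, hd⟩ := hdone
      have hconst : u = C (coeff 0 u) := by
        rw [← totalDegree_eq_zero_iff_eq_C, totalDegree_eq_zero_iff]
        exact fun m hm j => Nat.le_zero.1 (degreeOf_le_iff.1 (hd j).le m hm)
      have hc : coeff 0 u ≠ 0 := fun h => hu0 (by rw [hconst, h, C_0])
      refine ⟨0, le_rfl, AddMonoidHom.mulLeft (C (coeff 0 u)⁻¹), fun a b => ?_, ?_⟩
      · simp only [AddMonoidHom.coe_mulLeft, pow_zero, pow_one]
        ring
      · rw [AddMonoidHom.coe_mulLeft, pow_zero, Nat.sub_self, pow_zero, mul_one]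
        nth_rw 2 [hconst]
        rw [← C_mul, inv_mul_cancel₀ hc, C_1]
    · obtain ⟨ψ, hψ, hψ0, hψle, hψlt⟩ :=
        exists_isInverseLinear_mul_pow_sub_one p hF hF0 hreg hdvd
      have hsum : ∑ j, degreeOf j (ψ (u * F ^ (p - 1))) + (e₀ - 1) < N := by
        rw [hN]
        by_cases hz : ∀ j, degreeOf j u = 0
        · have := Finset.sum_le_sum fun j (_ : j ∈ Finset.univ) => hψle j
          have he : e₀ ≠ 0 := fun h => hdone ⟨h, hz⟩
          omega
        · push Not at hz
          obtain ⟨j, hj⟩ := hψlt hz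
          have := Finset.sum_lt_sum (fun j (_ : j ∈ Finset.univ) => hψle j)
            ⟨j, Finset.mem_univ j, hj⟩
          omega
      obtain ⟨e, he, φ, hφ, hφ1⟩ := ih _ hsum hψ0 (Nat.le_zero.1 ((hψle i).trans hu.le)) (e₀ - 1) rfl
      refine ⟨e + 1, by omega, φ.comp ψ, pow_succ p e ▸ hφ.comp hψ, ?_⟩
      have hp : 1 ≤ p := (Fact.out : p.Prime).one_le
      have hpe : 1 ≤ p ^ e := Nat.one_le_pow _ _ hp
      have hexp : p ^ (e + 1) - 1 = (p ^ e - 1) * p + (p - 1) := by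
        obtain ⟨a, ha⟩ := Nat.exists_eq_add_of_le hpe
        rw [pow_succ, ha, add_mul]
        simp only [Nat.add_sub_cancel_left]
        omega
      have : u * F ^ (p ^ (e + 1) - 1) = (F ^ (p ^ e - 1)) ^ p * (u * F ^ (p - 1)) := by
        rw [hexp, pow_add, pow_mul]
        ring
      rw [AddMonoidHom.comp_apply, this, hψ, mul_comm, hφ1]

end SquarefreeSupported

open TensorProduct

/-- An inverse linear map `φ` descends along a surjection `π` with kernel `(F)`, after multiplication
by `F ^ (q - 1)`. -/
theorem IsInverseLinear.exists_descent {S R : Type*} [CommRing S] [CommRing R] {q : ℕ} (hq : 1 ≤ q)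
    {φ : S →+ S} (hφ : IsInverseLinear q φ) {π : S →+* R} (hπ : Function.Surjective π) {F : S}
    (hker : ∀ s, π s = 0 ↔ F ∣ s) :
    ∃ ψ : R →+ R, IsInverseLinear q ψ ∧ ∀ s, ψ (π s) = π (φ (s * F ^ (q - 1))) := by
  let g : S →+ R := (π : S →+ R).comp (φ.comp (AddMonoidHom.mulRight (F ^ (q - 1))))
  have hg : (π : S →+ R).ker ≤ g.ker := by
    intro s hs
    obtain ⟨t, rfl⟩ := (hker s).1 hs
    -- The factor F^(q-1) completes F to a q-th power, which leaves φ as F.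
    have : F * t * F ^ (q - 1) = F ^ q * t := by
      rw [← mul_pow_sub_one (by omega : q ≠ 0) F]
      ring
    change π (φ (F * t * F ^ (q - 1))) = 0
    rw [this, hφ, hker]
    exact dvd_mul_right F _
  let ψ := AddMonoidHom.liftOfSurjective (π : S →+ R) hπ ⟨g, hg⟩
  have hψ (s) : ψ (π s) = π (φ (s * F ^ (q - 1))) :=
    AddMonoidHom.liftOfRightInverse_comp_apply _ _ (Function.rightInverse_surjInv hπ) ⟨g, hg⟩ s
  refine ⟨ψ, fun a b => ?_, hψ⟩
  obtain ⟨a, rfl⟩ := hπ a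
  obtain ⟨b, rfl⟩ := hπ b
  rw [← map_pow, ← map_mul, hψ, hψ, mul_assoc, hφ, map_mul]

theorem isTightlyClosed_of_isSquarefreeSupported {σ L R : Type*} [Fintype σ] [Field L] [CommRing R]
    [Nontrivial R] (p : ℕ) [Fact p.Prime] [CharP L p] {F : MvPolynomial σ L}
    (hF : IsSquarefreeSupported F) {i : σ} (hi : degreeOf i F = 1)
    (hreg : ∀ j u, pderiv j F ≠ 0 → F ∣ u * pderiv j F → F ∣ u)
    {π : MvPolynomial σ L →+* R} (hπ : Function.Surjective π) (hker : ∀ s, π s = 0 ↔ F ∣ s)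
    (I : Ideal R) : IsTightlyClosed p I := by
  refine isTightlyClosed_of_exists_isInverseLinear p (fun c hc e₀ => ?_) I
  have hc0 : c ≠ 0 := by
    rintro rfl
    obtain ⟨P, hP⟩ := Ideal.nonempty_minimalPrimes (bot_ne_top : (⊥ : Ideal R) ≠ ⊤)
    exact hc P hP P.zero_mem
  obtain ⟨u, rfl⟩ := hπ c
  rw [Ne, hker] at hc0
  obtain ⟨N, r, hr, hdvd⟩ := exists_dvd_pderiv_pow_mul_sub hi.le u
  have hπr : π (pderiv i F) ^ N * π u = π r := by
    rw [← map_pow, ← map_mul, ← sub_eq_zero, ← map_sub, hker]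
    exact hdvd
  have hr0 : r ≠ 0 := by
    rintro rfl
    rw [sub_zero] at hdvd
    refine hc0 ?_
    clear hπr
    induction N with
    | zero => simpa using hdvd
    | succ N ih =>
      refine ih (hreg i _ (pderiv_ne_zero_of_degreeOf_eq_one hi) ?_)
      rwa [mul_right_comm, ← pow_succ]
  obtain ⟨e, he, φ, hφ, h1⟩ :=
    exists_isInverseLinear_mul_pow_sub_one_eq_one p hF hreg hi hr0 hr e₀
  obtain ⟨ψ, hψ, hψφ⟩ :=
    hφ.exists_descent (Nat.one_le_pow _ _ (Fact.out : p.Prime).pos) hπ hker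
  refine ⟨e, he, _, hψ.comp_mulLeft (π (pderiv i F) ^ N), ?_⟩
  rw [AddMonoidHom.comp_apply, AddMonoidHom.coe_mulLeft, hπr, hψφ, h1, map_one]

/-! ### Base change to L -/

theorem eq_zero_of_mul_tmul_one_eq_zero {K L A : Type*} [Field K] [CommRing L] [Algebra K L]
    [CommRing A] [IsDomain A] [Algebra K A] {a : A} (ha : a ≠ 0) {x : A ⊗[K] L}
    (h : x * (a ⊗ₜ 1) = 0) : x = 0 := by
  refine Module.Flat.rTensor_preserves_injective_linearMap (M := L)
    (LinearMap.mulRight K a) (mul_left_injective₀ ha) ?_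
  rw [map_zero, ← h]
  clear h
  induction x with
  | zero => rw [map_zero, zero_mul]
  | add x y hx hy => rw [map_add, hx, hy, add_mul]
  | tmul b c => simp

theorem IsSquarefreeSupported.map {σ K L : Type*} [Field K] [Field L] {f : MvPolynomial σ K}
    (hf : IsSquarefreeSupported f) (φ : K →+* L) : IsSquarefreeSupported (MvPolynomial.map φ f) :=
  fun m hm => hf m (support_map_subset φ f hm)

section BaseChange

variable {σ : Type*} {K L : Type*} [Field K] [Field L] [Algebra K L] (f : MvPolynomial σ K)

/-- The presentation of `S/(f) ⊗ L` as a quotient of the polynomial ring over `L`. -/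
theorem exists_surjective_quotient_tensorProduct :
    ∃ π : MvPolynomial σ L →+* (MvPolynomial σ K ⧸ Ideal.span {f}) ⊗[K] L,
      Function.Surjective π ∧ (∀ s, π s = 0 ↔ MvPolynomial.map (algebraMap K L) f ∣ s) ∧
        ∀ g, π (MvPolynomial.map (algebraMap K L) g) = Ideal.Quotient.mk _ g ⊗ₜ 1 := by
  let E : MvPolynomial σ L ≃+* MvPolynomial σ K ⊗[K] L :=
    (algebraTensorAlgEquiv (σ := σ) K L).symm.toRingEquiv.trans
      (Algebra.TensorProduct.comm K L (MvPolynomial σ K)).toRingEquiv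
  have hE (g) : E (MvPolynomial.map (algebraMap K L) g) = g ⊗ₜ 1 := by
    change Algebra.TensorProduct.comm K L (MvPolynomial σ K)
      ((algebraTensorAlgEquiv K L).symm (MvPolynomial.map (algebraMap K L) g)) = _
    rw [algebraTensorAlgEquiv_symm_map, Algebra.TensorProduct.comm_tmul]
  let q := Ideal.Quotient.mkₐ K (Ideal.span {f})
  have hq : Function.Surjective q := Ideal.Quotient.mkₐ_surjective K _
  have hqker : RingHom.ker q = Ideal.span {f} := Ideal.Quotient.mkₐ_ker K _
  let T := Algebra.TensorProduct.map q (AlgHom.id K L)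
  have hT : Function.Surjective T :=
    TensorProduct.map_surjective hq Function.surjective_id
  refine ⟨T.toRingHom.comp E.toRingHom, hT.comp E.surjective, fun s => ?_, fun g => ?_⟩
  · have h1 : T (E s) = 0 ↔ E s ∈ RingHom.ker T := Iff.rfl
    change T (E s) = 0 ↔ _
    rw [h1, Algebra.TensorProduct.rTensor_ker q hq, hqker, Ideal.map_span,
      Set.image_singleton, Ideal.mem_span_singleton]
    change f ⊗ₜ 1 ∣ E s ↔ _
    rw [← hE, map_dvd_iff]
  · change T (E _) = _
    rw [hE]
    rfl

/-- Primality of f need not be known to survive over L, but g is a nonzerodivisor on the domain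
S/(f), and this survives the flat base change. -/
theorem map_dvd_of_map_dvd_mul_map {f g : MvPolynomial σ K} (hf : Prime f) (hg : ¬ f ∣ g)
    {u : MvPolynomial σ L}
    (h : MvPolynomial.map (algebraMap K L) f ∣ u * MvPolynomial.map (algebraMap K L) g) :
    MvPolynomial.map (algebraMap K L) f ∣ u := by
  obtain ⟨π, -, hker, hmap⟩ := exists_surjective_quotient_tensorProduct (L := L) f
  rw [← hker, map_mul, hmap] at h
  rw [← hker]
  have : (Ideal.span {f}).IsPrime := (Ideal.span_singleton_prime hf.ne_zero).2 hf
  have hg' : Ideal.Quotient.mk (Ideal.span {f}) g ≠ 0 := by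
    rwa [Ne, Ideal.Quotient.eq_zero_iff_mem, Ideal.mem_span_singleton]
  exact eq_zero_of_mul_tmul_one_eq_zero hg' h

end BaseChange

/-- The derivative has smaller degree in xⱼ than f. -/
theorem not_dvd_pderiv {σ K : Type*} [Field K] {f : MvPolynomial σ K} {j : σ}
    (hj : pderiv j f ≠ 0) : ¬ f ∣ pderiv j f := by
  rintro ⟨v, hv⟩
  have hf : f ≠ 0 := by
    rintro rfl
    simp at hj
  have hle := degreeOf_pderiv_le f j
  obtain ⟨m, hm⟩ := exists_coeff_ne_zero hj
  rw [coeff_pderiv] at hm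
  have h1 := degreeOf_le_iff.1 (le_refl (degreeOf j f)) _
    (mem_support_iff.2 (left_ne_zero_of_mul hm))
  simp only [Finsupp.add_apply, Finsupp.single_eq_same] at h1
  rw [hv] at hj
  rw [hv, degreeOf_mul_eq hf (right_ne_zero_of_mul hj)] at hle
  omega

theorem exists_degreeOf_ne_zero_of_irreducible {σ K : Type*} [Field K] {f : MvPolynomial σ K}
    (hf : Irreducible f) : ∃ i, degreeOf i f ≠ 0 := by
  by_contra! hd
  have hconst : f = C (coeff 0 f) := by
    rw [← totalDegree_eq_zero_iff_eq_C, totalDegree_eq_zero_iff]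
    exact fun m hm j => Nat.le_zero.1 (degreeOf_le_iff.1 (hd j).le m hm)
  refine hf.not_isUnit ?_
  rw [hconst]
  refine (IsUnit.mk0 _ fun h => hf.ne_zero ?_).map C
  rw [hconst, h, C_0]

end FSingularities

theorem mainTheorem2 (p : ℕ) [Fact p.Prime] (K : Type u) [Field K] [CharP K p] (n : ℕ)
    (f : MvPolynomial (Fin n) K) (hirr : Irreducible f)
    (hsq : FSingularities.IsSquarefreeSupported f) :
    FSingularities.IsGeometricallyFRational.{u, u, v} p K
      (MvPolynomial (Fin n) K ⧸ Ideal.span {f}) := by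
  intro L _ _
  have : CharP L p := charP_of_injective_algebraMap (algebraMap K L).injective p
  have : (Ideal.span {f}).IsPrime := (Ideal.span_singleton_prime hirr.ne_zero).2 hirr.prime
  obtain ⟨π, hπ, hker, -⟩ := FSingularities.exists_surjective_quotient_tensorProduct (L := L) f
  obtain ⟨i, hi⟩ := FSingularities.exists_degreeOf_ne_zero_of_irreducible hirr
  refine ⟨Fact.out, isNoetherianRing_of_surjective _ _ π hπ,
    charP_of_injective_algebraMap (algebraMap K _).injective p, fun I _ => ?_⟩
  refine FSingularities.isTightlyClosed_of_isSquarefreeSupported p (i := i)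
    (hsq.map (algebraMap K L)) ?_ (fun j u hj hu => ?_) hπ hker I
  · have := hsq.degreeOf_le i
    rw [MvPolynomial.degreeOf_def,
      MvPolynomial.degrees_map_of_injective _ (algebraMap K L).injective, ← MvPolynomial.degreeOf_def]
    omega
  · rw [MvPolynomial.pderiv_map] at hj hu
    refine FSingularities.map_dvd_of_map_dvd_mul_map hirr.prime
      (FSingularities.not_dvd_pderiv fun h => hj ?_) hu
    rw [h, map_zero]
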